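/- A Euclidean Jordan algebra is a finite-dimensional real inner product space $\mathbb X$ with a commutative bilinear product $\circ$ satisfying the Jordan identity $(x\circ y)\circ(x\circ x)=x\circ(y\circ(x\circ x))$, with a unit element $e_{\mathbb X}$, and such that $\langle x\circ y,z\rangle=\langle y,x\circ z\rangle$ for all $x,y,z\in\mathbb X$. Its symmetric cone is $K_{\mathbb X}=\{x\circ x:x\in\mathbb X\}$. A primitive idempotent of $\mathbb X$ is a nonzero $c$ with $c\circ c=c$ that is not the sum of two nonzero idempotents. Let $\mathbb X,\mathbb Y$ be Euclidean Jordan algebras, $\mathbb V$ a Euclidean space, and $G:\mathbb X\to\mathbb V$, $H:\mathbb Y\to\mathbb V$ linear maps such that $P=G(K_{\mathbb X})$ and $Q=H(K_{\mathbb Y})$ are LISC cones with these representations: $P$ and $Q$ are closed convex cones, $P\cap(-P)=Q\cap(-Q)=\{0\}$, $G(c)\ne0$ for every primitive idempotent $c\in\mathbb X$, and $H(c)\neq 0$ for every primitive idempotent $c\in\mathbb Y$. For a problem of the form $$\min\ \Psi(x,y)\quad\text{s.t.}\quad x\in K_{\mathbb X},\ \phi_1(x)=0,\quad y\in K_{\mathbb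 Y},\ \phi_2(y)=0,$$ with $\Psi,\phi_1,\phi_2$ differentiable over the feasible set, a solution is a global minimizer, and a stationary point is a feasible $(\bar x,\bar y)$ for which there are $\gamma_1,\gamma_2\in\mathbb R$ with $$\bar x\perp\nabla_x\Psi(\bar x,\bar y)+\gamma_1\nabla\phi_1(\bar x)\in K_{\mathbb X}^*,\qquad \bar y\perp\nabla_y\Psi(\bar x,\bar y)+\gamma_2\nabla\phi_2(\bar y)\in K_{\mathbb Y}^*,$$ where $K^*=\{\zeta:\langle\zeta,u\rangle\ge0\ \ \forall u\in K\}$ is the dual cone. Consider the spherical problem $$\text{(S)}\qquad\min\ \langle Gx,Hy\rangle\quad\text{s.t.}\quad x\in K_{\mathbb X},\ \|Gx\|-1=0,\quad y\in K_{\mathbb Y},\ \|Hy\|-1=0,$$ and the fractional program over the spectraplexes $$\text{(F)}\qquad\min\ \frac{\langle Gx,Hy\rangle}{\|Gx\|\,\|Hy\|}\quad\text{s.t.}\quad x\in K_{\mathbb X},\ \langle e_{\mathbb X},x\rangle-1=0,\quad y\in K_{\mathbb Y},\ \langle e_{\mathbb Y},y\rangle-1=0.$$ If $(\bar x,\bar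 y)$ is a stationary point (resp., solution) of (S), then $\left(\frac{\bar x}{\langle e_{\mathbb X},\bar x\rangle},\frac{\bar y}{\langle e_{\mathbb Y},\bar y\rangle}\right)$ is a stationary point (resp., solution) of (F). Conversely, if $(\tilde x,\tilde y)$ is a stationary point (resp., solution) of (F), then $\left(\frac{\tilde x}{\|G\tilde x\|},\frac{\tilde y}{\|H\tilde y\|}\right)$ is a stationary point (resp., solution) of (S). -/

import Mathlib

/-- A Euclidean Jordan algebra: a finite-dimensional real inner product space with a commutative
bilinear product `*` that satisfies the Jordan identity, has a unit element `1`, and for which the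
inner product is associative. -/
class EuclideanJordanAlgebra (X : Type*) [NormedAddCommGroup X] [InnerProductSpace ℝ X]
    [FiniteDimensional ℝ X] extends CommMagma X, One X, IsCommJordan X where
  add_mul' : ∀ x y z : X, (x + y) * z = x * z + y * z
  smul_mul' : ∀ (t : ℝ) (x y : X), (t • x) * y = t • (x * y)
  one_mul' : ∀ x : X, 1 * x = x
  inner_mul' : ∀ x y z : X, inner ℝ (x * y) z = inner ℝ y (x * z)

/-- Finite-dimensional real inner product spaces are complete (needed to speak of gradients). -/
instance (priority := 50) finiteDimensionalRealComplete (X : Type*) [NormedAddCommGroup X]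
    [InnerProductSpace ℝ X] [FiniteDimensional ℝ X] : CompleteSpace X :=
  FiniteDimensional.complete ℝ X

/-- The symmetric cone of a Euclidean Jordan algebra: its cone of squares. -/
def symmetricCone (X : Type*) [NormedAddCommGroup X] [InnerProductSpace ℝ X]
    [FiniteDimensional ℝ X] [EuclideanJordanAlgebra X] : Set X :=
  {z | ∃ x : X, z = x * x}

/-- A primitive idempotent: a nonzero idempotent that is not the sum of two nonzero idempotents. -/
def IsPrimitiveIdempotent {X : Type*} [NormedAddCommGroup X] [InnerProductSpace ℝ X]
    [FiniteDimensional ℝ X] [EuclideanJordanAlgebra X] (c : X) : Prop :=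
  c ≠ 0 ∧ IsIdempotentElem c ∧
    ¬ ∃ a b : X, a ≠ 0 ∧ b ≠ 0 ∧ IsIdempotentElem a ∧ IsIdempotentElem b ∧ c = a + b

/-- `P` is a LISC cone (linear image of a symmetric cone), represented as `P = G(K_X)`. -/
structure IsLISCCone {X V : Type*} [NormedAddCommGroup X] [InnerProductSpace ℝ X]
    [FiniteDimensional ℝ X] [EuclideanJordanAlgebra X]
    [NormedAddCommGroup V] [InnerProductSpace ℝ V]
    (P : Set V) (G : X →ₗ[ℝ] V) : Prop where
  isClosed : IsClosed P
  convex : Convex ℝ P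
  smul_mem : ∀ t : ℝ, 0 ≤ t → ∀ u ∈ P, t • u ∈ P
  image_eq : G '' symmetricCone X = P
  map_ne_zero : ∀ c : X, IsPrimitiveIdempotent c → G c ≠ 0
  pointed : ∀ u : V, u ∈ P → -u ∈ P → u = 0

/-- The dual cone of a set in a real inner product space. -/
def dualConeOf {X : Type*} [NormedAddCommGroup X] [InnerProductSpace ℝ X] (K : Set X) : Set X :=
  {z | ∀ u ∈ K, 0 ≤ inner ℝ z u}

/-- The data of the problem: minimize `obj x y` subject to `x ∈ KX`, `con₁ x = 0`,
`y ∈ KY`, `con₂ y = 0`. -/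
structure ConicProblem (X Y : Type*) where
  KX : Set X
  KY : Set Y
  obj : X → Y → ℝ
  con₁ : X → ℝ
  con₂ : Y → ℝ

/-- `(x, y)` is feasible. -/
structure ConicProblem.IsFeasible {X Y : Type*} (p : ConicProblem X Y) (x : X) (y : Y) :
    Prop where
  memX : x ∈ p.KX
  memY : y ∈ p.KY
  con₁_eq : p.con₁ x = 0
  con₂_eq : p.con₂ y = 0

/-- `(x, y)` is a solution, that is, a global minimizer over the feasible set. -/
def ConicProblem.IsSolution {X Y : Type*} (p : ConicProblem X Y) (x : X) (y : Y) : Prop :=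
  p.IsFeasible x y ∧ ∀ (x' : X) (y' : Y), p.IsFeasible x' y' → p.obj x y ≤ p.obj x' y'

/-- `(x, y)` is a stationary point: it is feasible, the functions involved are differentiable there
(so that the gradients below are genuine), and for some multipliers `γ₁`, `γ₂`,
`K_X ∋ x ⟂ ∇ₓ obj (x, y) + γ₁ ∇ con₁ x ∈ K_X*` and `K_Y ∋ y ⟂ ∇_y obj (x, y) + γ₂ ∇ con₂ y ∈ K_Y*`. -/
structure ConicProblem.IsStationary {X Y : Type*}
    [NormedAddCommGroup X] [InnerProductSpace ℝ X] [FiniteDimensional ℝ X]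
    [NormedAddCommGroup Y] [InnerProductSpace ℝ Y] [FiniteDimensional ℝ Y]
    (p : ConicProblem X Y) (x : X) (y : Y) : Prop where
  feasible : p.IsFeasible x y
  differentiable_obj : DifferentiableAt ℝ (fun q : X × Y => p.obj q.1 q.2) (x, y)
  differentiable_con₁ : DifferentiableAt ℝ p.con₁ x
  differentiable_con₂ : DifferentiableAt ℝ p.con₂ y
  exists_multipliers : ∃ γ₁ γ₂ : ℝ,
    (inner ℝ x (gradient (fun x' => p.obj x' y) x + γ₁ • gradient p.con₁ x) = 0 ∧
      gradient (fun x' => p.obj x' y) x + γ₁ • gradient p.con₁ x ∈ dualConeOf p.KX) ∧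
    (inner ℝ y (gradient (fun y' => p.obj x y') y + γ₂ • gradient p.con₂ y) = 0 ∧
      gradient (fun y' => p.obj x y') y + γ₂ • gradient p.con₂ y ∈ dualConeOf p.KY)

/-- The spherical problem: minimize `⟨G x, H y⟩` subject to `x ∈ K_X`, `‖G x‖ = 1`,
`y ∈ K_Y`, `‖H y‖ = 1`. -/
noncomputable def sphericalProblem {X Y V : Type*}
    [NormedAddCommGroup X] [InnerProductSpace ℝ X] [FiniteDimensional ℝ X]
    [EuclideanJordanAlgebra X]
    [NormedAddCommGroup Y] [InnerProductSpace ℝ Y] [FiniteDimensional ℝ Y]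
    [EuclideanJordanAlgebra Y]
    [NormedAddCommGroup V] [InnerProductSpace ℝ V]
    (G : X →ₗ[ℝ] V) (H : Y →ₗ[ℝ] V) : ConicProblem X Y where
  KX := symmetricCone X
  KY := symmetricCone Y
  obj := fun x y => inner ℝ (G x) (H y)
  con₁ := fun x => ‖G x‖ - 1
  con₂ := fun y => ‖H y‖ - 1

/-- The fractional program: minimize `⟨G x, H y⟩ / (‖G x‖ ‖H y‖)` over the product of the
spectraplexes `{x ∈ K_X : ⟨e_X, x⟩ = 1}` and `{y ∈ K_Y : ⟨e_Y, y⟩ = 1}`. -/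
noncomputable def fractionalProblem {X Y V : Type*}
    [NormedAddCommGroup X] [InnerProductSpace ℝ X] [FiniteDimensional ℝ X]
    [EuclideanJordanAlgebra X]
    [NormedAddCommGroup Y] [InnerProductSpace ℝ Y] [FiniteDimensional ℝ Y]
    [EuclideanJordanAlgebra Y]
    [NormedAddCommGroup V] [InnerProductSpace ℝ V]
    (G : X →ₗ[ℝ] V) (H : Y →ₗ[ℝ] V) : ConicProblem X Y where
  KX := symmetricCone X
  KY := symmetricCone Y
  obj := fun x y => inner ℝ (G x) (H y) / (‖G x‖ * ‖H y‖)
  con₁ := fun x => inner ℝ (1 : X) x - 1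
  con₂ := fun y => inner ℝ (1 : Y) y - 1

/-! The fractional objective is unchanged under positive scaling of `x` and of `y`, and it equals
the spherical one where `‖G x‖ = ‖H y‖ = 1`. Normalizing a point therefore carries each feasible set
into the other without changing the objective value, which settles solutions. For stationary points,
pairing the condition with the point itself determines each multiplier: it is `0` for the ratio, by
Euler's identity in degree zero, and minus the objective value on the sphere. With these multipliers
the two gradients in a block differ by a positive factor (`IsBlockStationary.ratio_of_inner`,
`IsBlockStationary.inner_of_ratio`). Normalization by `‖G x‖` requires `G x ≠ 0` for nonzero `x` in
the cone (`IsLISCCone.map_ne_zero_of_mem`), although only primitive idempotents are covered by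
assumption. A square is a nonnegative combination of idempotents, and pointedness prevents
cancellation among their images. The same pointedness, with a descent on the norm, passes from
primitive to arbitrary nonzero idempotents. -/

/-! ### Power associativity and spectral decomposition of squares -/

namespace EuclideanJordanAlgebra

variable {X : Type*} [NormedAddCommGroup X] [InnerProductSpace ℝ X]
  [FiniteDimensional ℝ X] [EuclideanJordanAlgebra X]

/-- The ring structure (commutative, nonassociative) of a Euclidean Jordan algebra. -/
abbrev toNonUnitalNonAssocCommRing : NonUnitalNonAssocCommRing X where
  __ := (inferInstance : AddCommGroup X)
  mul := (· * ·)
  mul_comm := mul_comm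
  left_distrib x y z := by
    change x * (y + z) = x * y + x * z
    rw [mul_comm, add_mul', mul_comm y, mul_comm z]
  right_distrib := add_mul'
  zero_mul x := by
    change (0 : X) * x = 0
    simpa using smul_mul' 0 (0 : X) x
  mul_zero x := by
    change x * (0 : X) = 0
    rw [mul_comm]
    simpa using smul_mul' 0 (0 : X) x

/-- Left multiplication as a bilinear map. -/
def lmul : X →ₗ[ℝ] Module.End ℝ X :=
  LinearMap.mk₂ ℝ (· * ·) add_mul' smul_mul'
    (fun x y z => by rw [mul_comm, add_mul', mul_comm y, mul_comm z])
    (fun t x y => by rw [mul_comm, smul_mul', mul_comm y])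

@[simp]
theorem lmul_apply (x y : X) : lmul x y = x * y := rfl

/-- Polarization of the Jordan identity, a sum of three commutators of multiplication operators,
evaluated at `d`; the factor 2 is cancelled over `ℝ`. -/
theorem jordan_linearized (a b c d : X) :
    a * ((b * c) * d) - (b * c) * (a * d) + (b * ((c * a) * d) - (c * a) * (b * d)) +
      (c * ((a * b) * d) - (a * b) * (c * d)) = 0 := by
  let _ := toNonUnitalNonAssocCommRing (X := X)
  have h := congrArg (fun f : AddMonoid.End X => f d)
    (two_nsmul_lie_lmul_lmul_add_add_eq_zero (A := X) a b c)
  have h2 : (2 : ℕ) • (a * ((b * c) * d) - (b * c) * (a * d) +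
      (b * ((c * a) * d) - (c * a) * (b * d)) + (c * ((a * b) * d) - (a * b) * (c * d))) = 0 := h
  rw [← Nat.cast_smul_eq_nsmul ℝ] at h2
  exact (smul_eq_zero.1 h2).resolve_left (by norm_num)

/-- Obtained by reading the linearized identity as a function of `b`. It expresses multiplication by
a triple product through multiplications by shorter products, which drives the induction on powers.
-/
theorem lmul_mul_mul (a c d : X) :
    lmul ((c * a) * d) = lmul (a * d) * lmul c + lmul (c * a) * lmul d + lmul (c * d) * lmul a
      - lmul a * lmul d * lmul c - lmul c * lmul d * lmul a := by
  ext b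
  have h := jordan_linearized a b c d
  simp only [LinearMap.sub_apply, LinearMap.add_apply, Module.End.mul_apply, lmul_apply]
  rw [mul_comm ((c * a) * d) b, mul_comm (a * d), mul_comm d b, mul_comm (c * d),
    mul_comm d (c * b), mul_comm d (a * b), mul_comm c b]
  rw [mul_comm (b * c) (a * d), mul_comm (a * b) (c * d)] at h
  rw [mul_comm (b * c) (a * d), mul_comm (a * b) (c * d), ← sub_eq_zero, ← h]
  abel

theorem commute_lmul_pow (a : X) (n : ℕ) : Commute (lmul ((lmul a ^ n) 1)) (lmul a) := by
  have h1 : lmul (1 : X) = 1 := by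
    ext x
    exact one_mul' x
  have h2 : Commute (lmul (a * a)) (lmul a) := by
    ext x
    exact IsJordan.lmul_lmul_comm_lmul a x
  induction n using Nat.twoStepInduction with
  | zero => simp [h1]
  | one => simp [mul_comm a 1, one_mul']
  | more n ih1 ih2 =>
    have e : (lmul a ^ (n + 1)) 1 = (lmul a ^ n) 1 * a := by
      rw [pow_succ', Module.End.mul_apply, lmul_apply, mul_comm]
    have : (lmul a ^ (n + 2)) 1 = ((lmul a ^ n) 1 * a) * a := by
      rw [pow_succ', Module.End.mul_apply, lmul_apply, mul_comm, e]
    rw [this, lmul_mul_mul, ← e]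
    have h0 : Commute (lmul a) (lmul a) := Commute.refl _
    exact ((((h2.mul_left ih1).add_left (ih2.mul_left h0)).add_left (ih2.mul_left h0)).sub_left
      ((h0.mul_left h0).mul_left ih1)).sub_left ((ih1.mul_left h0).mul_left h0)

open Polynomial

/-- Evaluation of a real polynomial at an element of a Euclidean Jordan algebra. -/
noncomputable def polyEval (a : X) : ℝ[X] →ₗ[ℝ] X :=
  (LinearMap.applyₗ (1 : X)).comp (aeval (lmul a)).toLinearMap

theorem polyEval_apply (a : X) (p : ℝ[X]) : polyEval a p = aeval (lmul a) p 1 := rfl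

theorem commute_lmul_polyEval (a : X) (p : ℝ[X]) : Commute (lmul (polyEval a p)) (lmul a) := by
  induction p using Polynomial.induction_on' with
  | add p q hp hq =>
    rw [map_add, map_add]
    exact hp.add_left hq
  | monomial n t =>
    have : polyEval a (monomial n t) = t • (lmul a ^ n) 1 := by
      rw [polyEval_apply, aeval_monomial]
      simp [Module.algebraMap_end_apply]
    rw [this, map_smul]
    exact (commute_lmul_pow a n).smul_left t

/-- Multiplication by `p(a)` commutes with `lmul a`, hence with `q(lmul a)`; applying both orders to
`1` gives the product rule. -/
theorem polyEval_mul (a : X) (p q : ℝ[X]) :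
    polyEval a (p * q) = polyEval a p * polyEval a q := by
  have h : Commute (lmul (polyEval a p)) (aeval (lmul a) q) := by
    induction q using Polynomial.induction_on with
    | C t =>
      rw [aeval_C]
      exact (Algebra.commutes t _).symm
    | add f g hf hg =>
      rw [map_add]
      exact hf.add_right hg
    | monomial n t ih =>
      rw [pow_succ, ← mul_assoc, map_mul, aeval_X]
      exact ih.mul_right (commute_lmul_polyEval a p)
  have h' := congrArg (fun f : Module.End ℝ X => f 1) h.eq
  simp only [Module.End.mul_apply, lmul_apply] at h'
  rw [mul_comm (polyEval a p) 1, one_mul'] at h'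
  rw [polyEval_apply a q, h', polyEval_apply, mul_comm, map_mul, Module.End.mul_apply,
    polyEval_apply]

theorem polyEval_X (a : X) : polyEval a Polynomial.X = a := by
  rw [polyEval_apply, aeval_X, lmul_apply, mul_comm, one_mul']

theorem lmul_isSymmetric (a : X) : (lmul a).IsSymmetric := fun x y => inner_mul' a x y

/-- The spectral decomposition of a square: a nonnegative combination of idempotents. -/
theorem mul_self_eq_sum_idempotents (a : X) :
    ∃ (s : Finset ℝ) (c : ℝ → X), (∀ μ, c μ * c μ = c μ) ∧ a * a = ∑ μ ∈ s, μ ^ 2 • c μ := by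
  classical
  set n := Module.finrank ℝ X with hn
  have hT := lmul_isSymmetric a
  let s : Finset ℝ := Finset.univ.image (hT.eigenvalues hn.symm)
  -- `lmul a` is symmetric, hence diagonalizable, so `p(a)` depends only on the values of `p` on the
  -- spectrum `s`.
  have key : ∀ p q : ℝ[X], (∀ μ ∈ s, p.eval μ = q.eval μ) → polyEval a p = polyEval a q := by
    intro p q hpq
    rw [polyEval_apply, polyEval_apply]
    congr 1
    refine (hT.eigenvectorBasis hn.symm).toBasis.ext fun i => ?_
    have hv := hT.hasEigenvector_eigenvectorBasis hn.symm i
    simp only [OrthonormalBasis.coe_toBasis]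
    rw [Module.End.aeval_apply_of_hasEigenvector hv, Module.End.aeval_apply_of_hasEigenvector hv]
    congr 1
    exact hpq _ (Finset.mem_image_of_mem _ (Finset.mem_univ i))
  have heval : ∀ μ ∈ s, ∀ ν ∈ s, (Lagrange.basis s id ν).eval μ = if ν = μ then 1 else 0 := by
    intro μ hμ ν hν
    split_ifs with h
    · subst h
      exact Lagrange.eval_basis_self (v := id) Function.injective_id.injOn hν
    · exact Lagrange.eval_basis_of_ne (v := id) h hμ
  -- Lagrange basis polynomials take only the values 0 and 1 on the spectrum, so they evaluate to
  -- idempotents.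
  refine ⟨s, fun μ => if μ ∈ s then polyEval a (Lagrange.basis s id μ) else 0, fun ν => ?_, ?_⟩
  · dsimp only
    split_ifs with hν
    · rw [← polyEval_mul]
      refine key _ _ fun μ hμ => ?_
      rw [eval_mul, heval μ hμ ν hν]
      split_ifs <;> norm_num
    · exact toNonUnitalNonAssocCommRing.zero_mul 0
  · have : a * a = polyEval a (∑ μ ∈ s, μ ^ 2 • Lagrange.basis s id μ) := by
      conv_lhs => rw [← polyEval_X a, ← polyEval_mul]
      refine key _ _ fun μ hμ => ?_
      rw [eval_finsetSum, Finset.sum_eq_single_of_mem μ hμ]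
      · rw [eval_smul, heval μ hμ μ hμ]
        simp [sq]
      · intro ν hν hne
        rw [eval_smul, heval μ hμ ν hν, if_neg hne, smul_zero]
    rw [this, map_sum]
    refine Finset.sum_congr rfl fun μ hμ => ?_
    simp only [map_smul, if_pos hμ]

end EuclideanJordanAlgebra

/-! ### Nonvanishing of the representing map on the symmetric cone -/

section SymmetricCone

open EuclideanJordanAlgebra

variable {X V : Type*} [NormedAddCommGroup X] [InnerProductSpace ℝ X]
  [FiniteDimensional ℝ X] [EuclideanJordanAlgebra X]
  [NormedAddCommGroup V] [InnerProductSpace ℝ V]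

theorem inner_one_mul_self (a : X) : inner ℝ (1 : X) (a * a) = ‖a‖ ^ 2 := by
  rw [← inner_mul' a 1 a, mul_comm, one_mul', real_inner_self_eq_norm_sq]

theorem inner_one_pos {x : X} (hx : x ∈ symmetricCone X) (h0 : x ≠ 0) :
    0 < inner ℝ (1 : X) x := by
  obtain ⟨a, rfl⟩ := hx
  rw [inner_one_mul_self]
  have : a ≠ 0 := by
    rintro rfl
    exact h0 (toNonUnitalNonAssocCommRing.zero_mul 0)
  positivity

theorem smul_mem_symmetricCone {t : ℝ} (ht : 0 ≤ t) {x : X} (hx : x ∈ symmetricCone X) :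
    t • x ∈ symmetricCone X := by
  obtain ⟨a, rfl⟩ := hx
  refine ⟨√t • a, ?_⟩
  rw [EuclideanJordanAlgebra.smul_mul', mul_comm a (√t • a), EuclideanJordanAlgebra.smul_mul',
    smul_smul, Real.mul_self_sqrt ht]

/-- Nonzero idempotents are bounded away from zero. -/
theorem exists_lower_bound_idempotent :
    ∃ δ : ℝ, 0 < δ ∧ ∀ c : X, c ≠ 0 → IsIdempotentElem c → δ ≤ ‖c‖ ^ 2 := by
  let B := (lmul (X := X)).toContinuousBilinearMap
  -- From `c = c * c` follows `‖c‖ ≤ ‖B‖ ‖c‖²`; the `+ 1` keeps the constant positive even if `B =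
  -- 0`.
  refine ⟨((‖B‖ + 1)⁻¹) ^ 2, by positivity, fun c hc hcc => ?_⟩
  have h1 : ‖c‖ ≤ ‖B‖ * ‖c‖ * ‖c‖ := by
    have := B.le_opNorm₂ c c
    have e : B c c = c := hcc
    rwa [e] at this
  have h2 : 0 < ‖c‖ := norm_pos_iff.2 hc
  have h3 : 1 ≤ ‖B‖ * ‖c‖ := by
    by_contra! h
    nlinarith
  gcongr
  rw [inv_le_iff_one_le_mul₀ (by positivity)]
  nlinarith

/-- On idempotents the squared norm is the linear functional `⟨1, c⟩`. -/
theorem norm_sq_add_idempotent {a b : X} (ha : IsIdempotentElem a) (hb : IsIdempotentElem b)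
    (hab : IsIdempotentElem (a + b)) : ‖a + b‖ ^ 2 = ‖a‖ ^ 2 + ‖b‖ ^ 2 := by
  rw [← inner_one_mul_self (a + b), ← inner_one_mul_self a, ← inner_one_mul_self b, hab.eq, ha.eq,
    hb.eq, inner_add_right]

variable {P : Set V} {G : X →ₗ[ℝ] V}

theorem IsLISCCone.map_mem (hP : IsLISCCone P G) {x : X} (hx : x ∈ symmetricCone X) : G x ∈ P :=
  hP.image_eq ▸ Set.mem_image_of_mem G hx

theorem IsLISCCone.add_mem (hP : IsLISCCone P G) {u v : V} (hu : u ∈ P) (hv : v ∈ P) :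
    u + v ∈ P := by
  have h := hP.smul_mem 2 (by norm_num) _
    (hP.convex hu hv (by norm_num : (0 : ℝ) ≤ 1 / 2) (by norm_num : (0 : ℝ) ≤ 1 / 2) (by norm_num))
  rw [smul_add, smul_smul, smul_smul] at h
  norm_num at h
  exact h

theorem IsLISCCone.eq_zero_of_add_eq_zero (hP : IsLISCCone P G) {u v : V} (hu : u ∈ P)
    (hv : v ∈ P) (h : u + v = 0) : u = 0 :=
  hP.pointed u hu (by rwa [neg_eq_of_add_eq_zero_right h])

theorem IsLISCCone.sum_mem (hP : IsLISCCone P G) {ι : Type*} (s : Finset ι) {f : ι → V}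
    (hf : ∀ i ∈ s, f i ∈ P) : ∑ i ∈ s, f i ∈ P := by
  classical
  induction s using Finset.induction_on with
  | empty =>
    have := hP.map_mem (smul_mem_symmetricCone le_rfl ⟨(1 : X), rfl⟩)
    rwa [zero_smul, map_zero] at this
  | insert i s hi ih =>
    rw [Finset.sum_insert hi]
    exact hP.add_mem (hf i (Finset.mem_insert_self i s))
      (ih fun j hj => hf j (Finset.mem_insert_of_mem hj))

/-- If `G c = 0` and `c = a + b` splits, pointedness forces `G a = 0`, while `‖a‖²` is smaller than
`‖c‖²` by at least the uniform bound `δ`. The descent must end, at a primitive idempotent killed by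
`G`. -/
theorem IsLISCCone.map_idempotent_ne_zero (hP : IsLISCCone P G) {c : X} (hc : c ≠ 0)
    (hcc : IsIdempotentElem c) : G c ≠ 0 := by
  obtain ⟨δ, hδ, hbd⟩ := exists_lower_bound_idempotent (X := X)
  have key : ∀ (n : ℕ) (c : X), c ≠ 0 → IsIdempotentElem c → ‖c‖ ^ 2 ≤ n * δ → G c ≠ 0 := by
    intro n
    induction n with
    | zero =>
      intro c hc hcc hn
      have := hbd c hc hcc
      simp only [Nat.cast_zero, zero_mul] at hn
      linarith
    | succ n ih =>
      intro c hc hcc hn hG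
      refine hP.map_ne_zero c ⟨hc, hcc, ?_⟩ hG
      rintro ⟨a, b, ha, hb, haa, hbb, rfl⟩
      have h1 := norm_sq_add_idempotent haa hbb hcc
      have h2 := hbd b hb hbb
      refine ih a ha haa ?_ (hP.eq_zero_of_add_eq_zero (hP.map_mem ⟨a, haa.symm⟩)
        (hP.map_mem ⟨b, hbb.symm⟩) (by rw [← map_add, hG]))
      push_cast at hn
      linarith
  obtain ⟨n, hn⟩ := exists_nat_ge (‖c‖ ^ 2 / δ)
  exact key n c hc hcc ((div_le_iff₀ hδ).1 hn)

/-- The representing map of a LISC cone vanishes on the symmetric cone only at the origin. -/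
theorem IsLISCCone.map_ne_zero_of_mem (hP : IsLISCCone P G) {x : X} (hx : x ∈ symmetricCone X)
    (h0 : x ≠ 0) : G x ≠ 0 := by
  classical
  obtain ⟨a, rfl⟩ := hx
  obtain ⟨s, c, hc, hsum⟩ := mul_self_eq_sum_idempotents a
  intro hG
  apply h0
  rw [hsum]
  refine Finset.sum_eq_zero fun μ hμ => ?_
  have hmem : ∀ ν ∈ s, G (ν ^ 2 • c ν) ∈ P := fun ν _ =>
    hP.map_mem (smul_mem_symmetricCone (sq_nonneg ν) ⟨c ν, (hc ν).symm⟩)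
  rw [hsum, map_sum, ← Finset.add_sum_erase s _ hμ] at hG
  -- Elements of a pointed cone with zero sum all vanish, so `G` kills each spectral term
  -- separately.
  have h := hP.eq_zero_of_add_eq_zero (hmem μ hμ)
    (hP.sum_mem _ fun ν hν => hmem ν (Finset.mem_of_mem_erase hν)) hG
  rw [map_smul, smul_eq_zero] at h
  rcases h with h | h
  · rw [h, zero_smul]
  · by_cases h' : c μ = 0
    · rw [h', smul_zero]
    · exact absurd h (hP.map_idempotent_ne_zero h' (hc μ))

end SymmetricCone

/-! ### First-order conditions in one block of variables -/

section BlockStationarity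

variable {X V : Type*} [NormedAddCommGroup X] [InnerProductSpace ℝ X]
  [NormedAddCommGroup V] [InnerProductSpace ℝ V]

variable (G : X →ₗ[ℝ] V)

theorem hasDerivAt_map_line (x u : X) : HasDerivAt (fun t : ℝ => G (x + t • u)) (G u) 0 := by
  simp only [map_add, map_smul]
  simpa using ((hasDerivAt_id (0 : ℝ)).smul_const (G u)).const_add (G x)

theorem hasDerivAt_inner_map_line (w : V) (x u : X) :
    HasDerivAt (fun t : ℝ => (inner ℝ (G (x + t • u)) w : ℝ)) (inner ℝ (G u) w) 0 := by
  simpa using (hasDerivAt_map_line G x u).inner ℝ (hasDerivAt_const (0 : ℝ) w)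

theorem hasDerivAt_norm_map_line {x : X} (hx : G x ≠ 0) (u : X) :
    HasDerivAt (fun t : ℝ => ‖G (x + t • u)‖) (inner ℝ (G x) (G u) / ‖G x‖) 0 := by
  have hx' : ‖G x‖ ≠ 0 := norm_ne_zero_iff.2 hx
  have h := (hasDerivAt_map_line G x u).norm_sq
  have h2 := h.sqrt (by simpa using hx)
  simp only [Real.sqrt_sq (norm_nonneg _), zero_smul, add_zero] at h2
  convert h2 using 1
  field_simp

theorem norm_map_inv_smul {G : X →ₗ[ℝ] V} {x : X} (h : G x ≠ 0) : ‖G (‖G x‖⁻¹ • x)‖ = 1 := by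
  rw [map_smul, norm_smul, norm_inv, norm_norm, inv_mul_cancel₀ (norm_ne_zero_iff.2 h)]

/-- Reduces every derivative needed here to one-variable calculus along a line. -/
theorem fderiv_eq_of_line {f : X → ℝ} {x u : X} {d : ℝ} (hf : DifferentiableAt ℝ f x)
    (h : HasDerivAt (fun t : ℝ => f (x + t • u)) d 0) : fderiv ℝ f x u = d := by
  rw [← hf.lineDeriv_eq_fderiv]
  exact HasLineDerivAt.lineDeriv h

theorem differentiableAt_inner_sub_one (e x : X) :
    DifferentiableAt ℝ (fun x => (inner ℝ e x : ℝ) - 1) x :=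
  ((differentiableAt_const e).inner ℝ differentiableAt_id).sub_const 1

theorem fderiv_inner_sub_one (e x u : X) :
    fderiv ℝ (fun x => (inner ℝ e x : ℝ) - 1) x u = inner ℝ e u := by
  refine fderiv_eq_of_line (differentiableAt_inner_sub_one e x) ?_
  simp only [inner_add_right, real_inner_smul_right]
  simpa using (((hasDerivAt_id (0 : ℝ)).mul_const (inner ℝ e u)).const_add (inner ℝ e x)).sub_const 1

variable [FiniteDimensional ℝ X]

/-- The first-order condition in one block of variables, for the objective `f`, the constraint
`g` and the cone `K`. -/
def IsBlockStationary (K : Set X) (f g : X → ℝ) (x : X) : Prop :=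
  ∃ γ : ℝ, inner ℝ x (gradient f x + γ • gradient g x) = 0 ∧
    gradient f x + γ • gradient g x ∈ dualConeOf K

theorem isBlockStationary_iff {K : Set X} {f g : X → ℝ} {x : X} :
    IsBlockStationary K f g x ↔ ∃ γ : ℝ, fderiv ℝ f x x + γ * fderiv ℝ g x x = 0 ∧
      ∀ u ∈ K, 0 ≤ fderiv ℝ f x u + γ * fderiv ℝ g x u := by
  have h : ∀ (γ : ℝ) (u : X), inner ℝ (gradient f x + γ • gradient g x) u =
      fderiv ℝ f x u + γ * fderiv ℝ g x u := by
    intro γ u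
    rw [inner_add_left, real_inner_smul_left, inner_gradient_left, inner_gradient_left]
  simp only [IsBlockStationary, dualConeOf, Set.mem_ofPred_eq, h, real_inner_comm _ x]

theorem differentiableAt_linearMap (x : X) : DifferentiableAt ℝ (fun x => G x) x :=
  G.toContinuousLinearMap.differentiableAt

theorem differentiableAt_norm_map {x : X} (hx : G x ≠ 0) :
    DifferentiableAt ℝ (fun x => ‖G x‖) x :=
  (differentiableAt_linearMap G x).norm ℝ hx

theorem fderiv_inner_map (w : V) (x u : X) :
    fderiv ℝ (fun x => (inner ℝ (G x) w : ℝ)) x u = inner ℝ (G u) w :=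
  fderiv_eq_of_line ((differentiableAt_linearMap G x).inner ℝ (differentiableAt_const w))
    (hasDerivAt_inner_map_line G w x u)

theorem fderiv_norm_map_sub_one {x : X} (hx : G x ≠ 0) (u : X) :
    fderiv ℝ (fun x => ‖G x‖ - 1) x u = inner ℝ (G x) (G u) / ‖G x‖ :=
  fderiv_eq_of_line ((differentiableAt_norm_map G hx).sub_const 1)
    ((hasDerivAt_norm_map_line G hx u).sub_const 1)

theorem fderiv_ratio (w : V) {c : ℝ} (hc : c ≠ 0) {x : X} (hx : G x ≠ 0) (u : X) :
    fderiv ℝ (fun x => (inner ℝ (G x) w : ℝ) / (‖G x‖ * c)) x u =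
      (inner ℝ (G u) w - inner ℝ (G x) w * inner ℝ (G x) (G u) / ‖G x‖ ^ 2) / (‖G x‖ * c) := by
  have hx' : ‖G x‖ ≠ 0 := norm_ne_zero_iff.2 hx
  refine fderiv_eq_of_line ?_ ?_
  · simp only [div_eq_mul_inv]
    exact ((differentiableAt_linearMap G x).inner ℝ (differentiableAt_const w)).mul
      (((differentiableAt_norm_map G hx).mul_const c).inv (mul_ne_zero hx' hc))
  · have h := (hasDerivAt_inner_map_line G w x u).div
      ((hasDerivAt_norm_map_line G hx u).mul_const c) (by simpa using ⟨hx, hc⟩)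
    simp only [zero_smul, add_zero] at h
    refine h.congr_deriv ?_
    field_simp

theorem IsBlockStationary.ratio_of_inner {K : Set X} {w : V} (hw : ‖w‖ = 1) {x : X}
    (hx : ‖G x‖ = 1)
    (h : IsBlockStationary K (fun x => (inner ℝ (G x) w : ℝ)) (fun x => ‖G x‖ - 1) x)
    (e : X) {r s : ℝ} (hr : 0 < r) (hs : 0 < s) :
    IsBlockStationary K (fun x => (inner ℝ (G x) (s • w) : ℝ) / (‖G x‖ * ‖s • w‖))
      (fun x => (inner ℝ e x : ℝ) - 1) (r • x) := by
  rw [isBlockStationary_iff] at h ⊢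
  have hx0 : G x ≠ 0 := norm_ne_zero_iff.1 (by rw [hx]; exact one_ne_zero)
  have hrx : G (r • x) ≠ 0 := by
    rw [map_smul]
    exact smul_ne_zero hr.ne' hx0
  have hsw : ‖s • w‖ = s := by rw [norm_smul, hw, mul_one, Real.norm_of_nonneg hs.le]
  have hnr : ‖G (r • x)‖ = r := by
    rw [map_smul, norm_smul, hx, mul_one, Real.norm_of_nonneg hr.le]
  have hself : (inner ℝ (G x) (G x) : ℝ) = 1 := by rw [real_inner_self_eq_norm_sq, hx, one_pow]
  obtain ⟨γ, h0, hK⟩ := h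
  simp only [fderiv_inner_map, fderiv_norm_map_sub_one G hx0, hx, hself] at h0 hK
  -- Complementarity determines the multiplier, because the constraint has derivative 1 in the
  -- direction `x`.
  have hγ : γ = -inner ℝ (G x) w := by linarith
  have hd : ∀ u, fderiv ℝ (fun x => (inner ℝ (G x) (s • w) : ℝ) / (‖G x‖ * ‖s • w‖)) (r • x) u =
      (inner ℝ (G u) w - inner ℝ (G x) w * inner ℝ (G x) (G u)) / r := by
    intro u
    rw [fderiv_ratio G _ (by rw [hsw]; exact hs.ne') hrx, hsw, hnr]
    simp only [map_smul, real_inner_smul_left, real_inner_smul_right]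
    field_simp
  -- The ratio is homogeneous of degree zero, so its derivative along the point itself vanishes and
  -- no multiplier is needed; hence `e` may be arbitrary.
  refine ⟨0, ?_, fun u hu => ?_⟩
  · rw [hd, map_smul, real_inner_smul_left, real_inner_smul_right, hself]
    ring
  · rw [hd, zero_mul, add_zero]
    refine div_nonneg ?_ hr.le
    have := hK u hu
    rw [hγ] at this
    linarith

theorem IsBlockStationary.inner_of_ratio {K : Set X} {w : V} (hw : w ≠ 0) {x : X} (hx : G x ≠ 0)
    {e : X} (he : inner ℝ e x = (1 : ℝ))
    (h : IsBlockStationary K (fun x => (inner ℝ (G x) w : ℝ) / (‖G x‖ * ‖w‖))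
      (fun x => (inner ℝ e x : ℝ) - 1) x) :
    IsBlockStationary K (fun x => (inner ℝ (G x) (‖w‖⁻¹ • w) : ℝ)) (fun x => ‖G x‖ - 1)
      (‖G x‖⁻¹ • x) := by
  rw [isBlockStationary_iff] at h ⊢
  have hx' : 0 < ‖G x‖ := norm_pos_iff.2 hx
  have hw' : 0 < ‖w‖ := norm_pos_iff.2 hw
  have hrx : G (‖G x‖⁻¹ • x) ≠ 0 := by
    rw [map_smul]
    exact smul_ne_zero (inv_ne_zero hx'.ne') hx
  have hnr : ‖G (‖G x‖⁻¹ • x)‖ = 1 := by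
    rw [map_smul, norm_smul, norm_inv, norm_norm, inv_mul_cancel₀ hx'.ne']
  have hself := real_inner_self_eq_norm_sq (G x)
  obtain ⟨γ, h0, hK⟩ := h
  simp only [fderiv_ratio G w hw'.ne' hx, fderiv_inner_sub_one, he, hself] at h0 hK
  -- The ratio has zero derivative in the direction `x` and `⟨e, x⟩ = 1`, so complementarity reduces
  -- to `γ = 0`.
  rw [mul_div_cancel_right₀ _ (by positivity), sub_self, zero_div, zero_add, mul_one] at h0
  have hf : ∀ u, fderiv ℝ (fun x => (inner ℝ (G x) (‖w‖⁻¹ • w) : ℝ)) (‖G x‖⁻¹ • x) u =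
      ‖w‖⁻¹ * inner ℝ (G u) w := by
    intro u
    rw [fderiv_inner_map, real_inner_smul_right]
  have hg : ∀ u, fderiv ℝ (fun x => ‖G x‖ - 1) (‖G x‖⁻¹ • x) u =
      ‖G x‖⁻¹ * inner ℝ (G x) (G u) := by
    intro u
    rw [fderiv_norm_map_sub_one G hrx, hnr, div_one, map_smul, real_inner_smul_left]
  simp only [hf, hg]
  simp only [map_smul, real_inner_smul_left, real_inner_smul_right, hself]
  -- Minus the spherical objective at the normalized point, the only value compatible with
  -- complementarity.
  refine ⟨-(‖G x‖⁻¹ * (‖w‖⁻¹ * inner ℝ (G x) w)), ?_, fun u hu => ?_⟩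
  · field_simp
    ring
  -- `‖G x‖` is the positive factor between the ratio's derivative and the spherical expression.
  · have := mul_nonneg hx'.le (hK u hu)
    rw [h0, zero_mul, add_zero] at this
    refine this.trans_eq ?_
    field_simp
    ring

end BlockStationarity

/-! ### Transfer of feasibility, stationarity and optimality -/

section Equivalence

open EuclideanJordanAlgebra

variable {X Y V : Type*}
    [NormedAddCommGroup X] [InnerProductSpace ℝ X] [FiniteDimensional ℝ X]
    [EuclideanJordanAlgebra X]
    [NormedAddCommGroup Y] [InnerProductSpace ℝ Y] [FiniteDimensional ℝ Y]
    [EuclideanJordanAlgebra Y]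
    [NormedAddCommGroup V] [InnerProductSpace ℝ V]
    {P Q : Set V} {G : X →ₗ[ℝ] V} {H : Y →ₗ[ℝ] V}

theorem inner_one_pos_of_norm_map_eq_one {x : X} (hx : x ∈ symmetricCone X) (h : ‖G x‖ = 1) :
    0 < inner ℝ (1 : X) x := by
  refine inner_one_pos hx ?_
  rintro rfl
  simp at h

theorem IsLISCCone.map_ne_zero_of_inner_one (hP : IsLISCCone P G) {x : X}
    (hx : x ∈ symmetricCone X) (h : inner ℝ (1 : X) x = (1 : ℝ)) : G x ≠ 0 := by
  refine hP.map_ne_zero_of_mem hx ?_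
  rintro rfl
  simp at h

theorem fractionalProblem_isFeasible_of_sphericalProblem {x : X} {y : Y}
    (h : (sphericalProblem G H).IsFeasible x y) :
    (fractionalProblem G H).IsFeasible
      ((inner ℝ (1 : X) x)⁻¹ • x) ((inner ℝ (1 : Y) y)⁻¹ • y) := by
  have hx := inner_one_pos_of_norm_map_eq_one h.memX (sub_eq_zero.1 h.con₁_eq)
  have hy := inner_one_pos_of_norm_map_eq_one h.memY (sub_eq_zero.1 h.con₂_eq)
  refine ⟨smul_mem_symmetricCone (inv_nonneg.2 hx.le) h.memX,
    smul_mem_symmetricCone (inv_nonneg.2 hy.le) h.memY, ?_, ?_⟩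
  · simp only [fractionalProblem, real_inner_smul_right]
    rw [inv_mul_cancel₀ hx.ne', sub_self]
  · simp only [fractionalProblem, real_inner_smul_right]
    rw [inv_mul_cancel₀ hy.ne', sub_self]

theorem sphericalProblem_isFeasible_of_fractionalProblem (hP : IsLISCCone P G)
    (hQ : IsLISCCone Q H) {x : X} {y : Y} (h : (fractionalProblem G H).IsFeasible x y) :
    (sphericalProblem G H).IsFeasible (‖G x‖⁻¹ • x) (‖H y‖⁻¹ • y) := by
  have hx := hP.map_ne_zero_of_inner_one h.memX (sub_eq_zero.1 h.con₁_eq)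
  have hy := hQ.map_ne_zero_of_inner_one h.memY (sub_eq_zero.1 h.con₂_eq)
  exact ⟨smul_mem_symmetricCone (inv_nonneg.2 (norm_nonneg _)) h.memX,
    smul_mem_symmetricCone (inv_nonneg.2 (norm_nonneg _)) h.memY,
    sub_eq_zero.2 (norm_map_inv_smul hx), sub_eq_zero.2 (norm_map_inv_smul hy)⟩

theorem fractionalProblem_obj_smul {x : X} {y : Y} {r s : ℝ} (hr : 0 < r) (hs : 0 < s) :
    (fractionalProblem G H).obj (r • x) (s • y) = (fractionalProblem G H).obj x y := by
  simp only [fractionalProblem, map_smul, real_inner_smul_left, real_inner_smul_right, norm_smul,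
    Real.norm_of_nonneg hr.le, Real.norm_of_nonneg hs.le]
  rw [← mul_assoc, mul_mul_mul_comm, mul_comm s r, mul_div_mul_left _ _ (mul_pos hr hs).ne']

theorem fractionalProblem_obj_of_norm_eq_one {x : X} {y : Y} (hx : ‖G x‖ = 1) (hy : ‖H y‖ = 1) :
    (fractionalProblem G H).obj x y = (sphericalProblem G H).obj x y := by
  simp [fractionalProblem, sphericalProblem, hx, hy]

theorem sphericalProblem_obj_normalize {x : X} {y : Y} (hx : G x ≠ 0) (hy : H y ≠ 0) :
    (sphericalProblem G H).obj (‖G x‖⁻¹ • x) (‖H y‖⁻¹ • y) = (fractionalProblem G H).obj x y := by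
  rw [← fractionalProblem_obj_of_norm_eq_one (norm_map_inv_smul hx) (norm_map_inv_smul hy),
    fractionalProblem_obj_smul (inv_pos.2 (norm_pos_iff.2 hx)) (inv_pos.2 (norm_pos_iff.2 hy))]

theorem fractionalProblem_obj_normalize {x : X} {y : Y}
    (h : (sphericalProblem G H).IsFeasible x y) :
    (fractionalProblem G H).obj ((inner ℝ (1 : X) x)⁻¹ • x) ((inner ℝ (1 : Y) y)⁻¹ • y) =
      (sphericalProblem G H).obj x y := by
  have hx := sub_eq_zero.1 h.con₁_eq
  have hy := sub_eq_zero.1 h.con₂_eq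
  rw [fractionalProblem_obj_smul
    (inv_pos.2 (inner_one_pos_of_norm_map_eq_one h.memX hx))
    (inv_pos.2 (inner_one_pos_of_norm_map_eq_one h.memY hy)),
    fractionalProblem_obj_of_norm_eq_one hx hy]

theorem differentiableAt_sphericalProblem_obj (q : X × Y) :
    DifferentiableAt ℝ (fun q : X × Y => (sphericalProblem G H).obj q.1 q.2) q :=
  ((differentiableAt_linearMap G q.1).comp (f := Prod.fst) q differentiableAt_fst).inner ℝ
    ((differentiableAt_linearMap H q.2).comp (f := Prod.snd) q differentiableAt_snd)

theorem differentiableAt_fractionalProblem_obj {x : X} {y : Y} (hx : G x ≠ 0) (hy : H y ≠ 0) :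
    DifferentiableAt ℝ (fun q : X × Y => (fractionalProblem G H).obj q.1 q.2) (x, y) := by
  simp only [fractionalProblem, div_eq_mul_inv]
  exact (differentiableAt_sphericalProblem_obj (G := G) (H := H) (x, y)).mul
    ((((differentiableAt_norm_map G hx).comp (f := Prod.fst) (x, y) differentiableAt_fst).mul
      ((differentiableAt_norm_map H hy).comp (f := Prod.snd) (x, y) differentiableAt_snd)).inv
        (mul_ne_zero (norm_ne_zero_iff.2 hx) (norm_ne_zero_iff.2 hy)))

theorem ConicProblem.IsStationary.fractionalProblem_of_sphericalProblem {x : X} {y : Y}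
    (h : (sphericalProblem G H).IsStationary x y) :
    (fractionalProblem G H).IsStationary
      ((inner ℝ (1 : X) x)⁻¹ • x) ((inner ℝ (1 : Y) y)⁻¹ • y) := by
  have hf := h.feasible
  have hx : ‖G x‖ = 1 := sub_eq_zero.1 hf.con₁_eq
  have hy : ‖H y‖ = 1 := sub_eq_zero.1 hf.con₂_eq
  have hr := inv_pos.2 (inner_one_pos_of_norm_map_eq_one hf.memX hx)
  have hs := inv_pos.2 (inner_one_pos_of_norm_map_eq_one hf.memY hy)
  have hx0 : G x ≠ 0 := norm_ne_zero_iff.1 (by rw [hx]; exact one_ne_zero)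
  have hy0 : H y ≠ 0 := norm_ne_zero_iff.1 (by rw [hy]; exact one_ne_zero)
  obtain ⟨γ₁, γ₂, h₁, h₂⟩ := h.exists_multipliers
  have hb₁ : IsBlockStationary (symmetricCone X) (fun x => (inner ℝ (G x) (H y) : ℝ))
    (fun x => ‖G x‖ - 1) x := ⟨γ₁, h₁⟩
  have hb₂ : IsBlockStationary (symmetricCone Y) (fun y => (inner ℝ (G x) (H y) : ℝ))
    (fun y => ‖H y‖ - 1) y := ⟨γ₂, h₂⟩
  -- Puts `H y` in the first slot, so that the block lemma applies to `y` with `H` in the role of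
  -- `G`; the result is swapped back below.
  simp only [fun y => real_inner_comm (H y) (G x)] at hb₂
  obtain ⟨δ₁, k₁⟩ := hb₁.ratio_of_inner G hy hx 1 hr hs
  have k := hb₂.ratio_of_inner H hx hy 1 hs hr
  simp only [fun y => real_inner_comm ((inner ℝ (1 : X) x : ℝ)⁻¹ • G x) (H y),
    fun y => mul_comm ‖H y‖ ‖(inner ℝ (1 : X) x : ℝ)⁻¹ • G x‖] at k
  obtain ⟨δ₂, k₂⟩ := k
  rw [← map_smul] at k₁ k₂
  exact ⟨fractionalProblem_isFeasible_of_sphericalProblem hf,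
    differentiableAt_fractionalProblem_obj (by rw [map_smul]; exact smul_ne_zero hr.ne' hx0)
      (by rw [map_smul]; exact smul_ne_zero hs.ne' hy0),
    differentiableAt_inner_sub_one _ _, differentiableAt_inner_sub_one _ _, δ₁, δ₂, k₁, k₂⟩

theorem ConicProblem.IsStationary.sphericalProblem_of_fractionalProblem (hP : IsLISCCone P G)
    (hQ : IsLISCCone Q H) {x : X} {y : Y} (h : (fractionalProblem G H).IsStationary x y) :
    (sphericalProblem G H).IsStationary (‖G x‖⁻¹ • x) (‖H y‖⁻¹ • y) := by
  have hf := h.feasible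
  have ex : inner ℝ (1 : X) x = (1 : ℝ) := sub_eq_zero.1 hf.con₁_eq
  have ey : inner ℝ (1 : Y) y = (1 : ℝ) := sub_eq_zero.1 hf.con₂_eq
  have hx : G x ≠ 0 := hP.map_ne_zero_of_inner_one hf.memX ex
  have hy : H y ≠ 0 := hQ.map_ne_zero_of_inner_one hf.memY ey
  obtain ⟨γ₁, γ₂, h₁, h₂⟩ := h.exists_multipliers
  have hb₁ : IsBlockStationary (symmetricCone X)
    (fun x => (inner ℝ (G x) (H y) : ℝ) / (‖G x‖ * ‖H y‖))
    (fun x => (inner ℝ (1 : X) x : ℝ) - 1) x := ⟨γ₁, h₁⟩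
  have hb₂ : IsBlockStationary (symmetricCone Y)
    (fun y => (inner ℝ (G x) (H y) : ℝ) / (‖G x‖ * ‖H y‖))
    (fun y => (inner ℝ (1 : Y) y : ℝ) - 1) y := ⟨γ₂, h₂⟩
  simp only [fun y => real_inner_comm (H y) (G x), fun y => mul_comm ‖G x‖ ‖H y‖] at hb₂
  obtain ⟨δ₁, k₁⟩ := hb₁.inner_of_ratio G hy hx ex
  have k := hb₂.inner_of_ratio H hx hy ey
  simp only [fun y => real_inner_comm (‖G x‖⁻¹ • G x) (H y)] at k
  obtain ⟨δ₂, k₂⟩ := k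
  rw [← map_smul] at k₁ k₂
  have hxn : G (‖G x‖⁻¹ • x) ≠ 0 := norm_ne_zero_iff.1 (by rw [norm_map_inv_smul hx]; exact one_ne_zero)
  have hyn : H (‖H y‖⁻¹ • y) ≠ 0 := norm_ne_zero_iff.1 (by rw [norm_map_inv_smul hy]; exact one_ne_zero)
  exact ⟨sphericalProblem_isFeasible_of_fractionalProblem hP hQ hf,
    differentiableAt_sphericalProblem_obj _, (differentiableAt_norm_map G hxn).sub_const 1,
    (differentiableAt_norm_map H hyn).sub_const 1, δ₁, δ₂, k₁, k₂⟩

theorem ConicProblem.IsSolution.fractionalProblem_of_sphericalProblem (hP : IsLISCCone P G)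
    (hQ : IsLISCCone Q H) {x : X} {y : Y} (h : (sphericalProblem G H).IsSolution x y) :
    (fractionalProblem G H).IsSolution
      ((inner ℝ (1 : X) x)⁻¹ • x) ((inner ℝ (1 : Y) y)⁻¹ • y) := by
  refine ⟨fractionalProblem_isFeasible_of_sphericalProblem h.1, fun x' y' h' => ?_⟩
  -- Normalizing the competitor onto the sphere keeps its value, so optimality in the spherical
  -- problem applies.
  rw [fractionalProblem_obj_normalize h.1, ← sphericalProblem_obj_normalize
    (hP.map_ne_zero_of_inner_one h'.memX (sub_eq_zero.1 h'.con₁_eq))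
    (hQ.map_ne_zero_of_inner_one h'.memY (sub_eq_zero.1 h'.con₂_eq))]
  exact h.2 _ _ (sphericalProblem_isFeasible_of_fractionalProblem hP hQ h')

theorem ConicProblem.IsSolution.sphericalProblem_of_fractionalProblem (hP : IsLISCCone P G)
    (hQ : IsLISCCone Q H) {x : X} {y : Y} (h : (fractionalProblem G H).IsSolution x y) :
    (sphericalProblem G H).IsSolution (‖G x‖⁻¹ • x) (‖H y‖⁻¹ • y) := by
  refine ⟨sphericalProblem_isFeasible_of_fractionalProblem hP hQ h.1, fun x' y' h' => ?_⟩
  rw [← fractionalProblem_obj_normalize h', sphericalProblem_obj_normalize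
    (hP.map_ne_zero_of_inner_one h.1.memX (sub_eq_zero.1 h.1.con₁_eq))
    (hQ.map_ne_zero_of_inner_one h.1.memY (sub_eq_zero.1 h.1.con₂_eq))]
  exact h.2 _ _ (fractionalProblem_isFeasible_of_sphericalProblem h')

end Equivalence

theorem theorem3p5 {X Y V : Type*}
    [NormedAddCommGroup X] [InnerProductSpace ℝ X] [FiniteDimensional ℝ X]
    [EuclideanJordanAlgebra X]
    [NormedAddCommGroup Y] [InnerProductSpace ℝ Y] [FiniteDimensional ℝ Y]
    [EuclideanJordanAlgebra Y]
    [NormedAddCommGroup V] [InnerProductSpace ℝ V] [FiniteDimensional ℝ V]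
    (P Q : Set V) (G : X →ₗ[ℝ] V) (H : Y →ₗ[ℝ] V)
    (hP : IsLISCCone P G) (hQ : IsLISCCone Q H) :
    (∀ (x : X) (y : Y), (sphericalProblem G H).IsStationary x y →
      (fractionalProblem G H).IsStationary
        ((inner ℝ (1 : X) x)⁻¹ • x) ((inner ℝ (1 : Y) y)⁻¹ • y)) ∧
    (∀ (x : X) (y : Y), (sphericalProblem G H).IsSolution x y →
      (fractionalProblem G H).IsSolution
        ((inner ℝ (1 : X) x)⁻¹ • x) ((inner ℝ (1 : Y) y)⁻¹ • y)) ∧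
    (∀ (x : X) (y : Y), (fractionalProblem G H).IsStationary x y →
      (sphericalProblem G H).IsStationary (‖G x‖⁻¹ • x) (‖H y‖⁻¹ • y)) ∧
    (∀ (x : X) (y : Y), (fractionalProblem G H).IsSolution x y →
      (sphericalProblem G H).IsSolution (‖G x‖⁻¹ • x) (‖H y‖⁻¹ • y)) := by
  exact ⟨fun _ _ h => h.fractionalProblem_of_sphericalProblem,
    fun _ _ h => h.fractionalProblem_of_sphericalProblem hP hQ,
    fun _ _ h => h.sphericalProblem_of_fractionalProblem hP hQ,
    fun _ _ h => h.sphericalProblem_of_fractionalProblem hP hQ⟩
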